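/- A partition is a sequence $\mu_1\ge\mu_2\ge\cdots$ of nonnegative integers with only finitely many nonzero terms; $|\mu|=\sum_j\mu_j$. For $r\ge 1$ and a profile $\boldsymbol c=(c_i)_{i\in\mathbb Z/r\mathbb Z}$ of nonnegative integers, a cylindric partition of profile $\boldsymbol c$ is a family $\boldsymbol\lambda=(\lambda^{(i)})_{i\in\mathbb Z/r\mathbb Z}$ of partitions such that $\lambda^{(i)}_j\ge\lambda^{(i+1)}_{j+c_{i+1}}$ for all $i\in\mathbb Z/r\mathbb Z$ and $j\ge 1$. Let $\max(\boldsymbol\lambda)$ be its largest part (with $\max(\boldsymbol\lambda)=0$ if all $\lambda^{(i)}$ are empty), let $|\boldsymbol\lambda|=\sum_i|\lambda^{(i)}|$, and put $$F_{\boldsymbol c}(x,q)=\sum_{\boldsymbol\lambda}x^{\max(\boldsymbol\lambda)}q^{|\boldsymbol\lambda|},\qquad G_{\boldsymbol c}(x,q)=(xq;q)_\infty F_{\boldsymbol c}(x,q),$$ where the sum is over all cylindric partitions of profile $\boldsymbol c$, $(u;t)_n=\prod_{0\le j<n}(1-ut^j)$ and $(u;t)_\infty=\prod_{j\ge 0}(1-ut^j)$.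 Proposition 7.2. For the profile $(1,1,1)$ (so $r=3$), the sum defining $F_{(1,1,1)}(x,q)$, the product $(xq;q)_\infty$ and the sum below converge in the ring of formal power series in $x,q$ with integer coefficients (in the sense of coefficientwise stabilization), and $$G_{(1,1,1)}(x,q)=\sum_{a,b,c,d\ge 0}\frac{q^{a^2+b^2+3c^2+3d^2+2ab+3ac+3ad+3bc+3bd+6cd}}{(q;q)_a(q;q)_b(q^3;q^3)_c(q^3;q^3)_d}\,x^{a+b+c+2d}.$$ -/

import Mathlib

open PowerSeries
open scoped PowerSeries.WithPiTopology

/-- Formal power series in `q` with integer coefficients. -/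
abbrev QSeries : Type := PowerSeries ℤ

/-- Formal power series in `x` over `ℤ⟦q⟧`, i.e. elements of `ℤ⟦q⟧⟦x⟧ = ℤ⟦x, q⟧`.
The scoped topology (applied twice, over the discrete ring `ℤ`) is that of coefficientwise
stabilisation, the usual one in which infinite sums and products of formal series are taken. -/
abbrev XQSeries : Type := PowerSeries QSeries

/-- The variable `q` in `ℤ⟦q⟧`. -/
noncomputable def qVar : QSeries := PowerSeries.X

/-- The variable `x` in `ℤ⟦q⟧⟦x⟧`. -/
noncomputable def xVar : XQSeries := PowerSeries.X

/-- The variable `q`, seen in `ℤ⟦q⟧⟦x⟧`. -/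
noncomputable def qVar' : XQSeries := PowerSeries.C qVar

/-- The finite `q`-Pochhammer symbol `(a; t)_n = ∏_{0 ≤ j < n} (1 - a t^j)`. -/
def qPoch {A : Type*} [CommRing A] (a t : A) (n : ℕ) : A :=
  ∏ j ∈ Finset.range n, (1 - a * t ^ j)

/-- The infinite `q`-Pochhammer symbol `(a; t)_∞ = ∏_{j ≥ 0} (1 - a t^j)`. -/
noncomputable def qPochInf {A : Type*} [CommRing A] [TopologicalSpace A] (a t : A) : A :=
  ∏' j : ℕ, (1 - a * t ^ j)

/-- The symbols `(q^k; q^k)_n` with `k ≥ 1` are invertible in `ℤ⟦q⟧`. -/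
theorem isUnit_qPoch (k n : ℕ) (hk : 1 ≤ k) : IsUnit (qPoch (qVar ^ k) (qVar ^ k) n) := by
  rw [PowerSeries.isUnit_iff_constantCoeff]
  have : (PowerSeries.constantCoeff (R := ℤ)) (qPoch (qVar ^ k) (qVar ^ k) n) = 1 := by
    unfold qPoch
    rw [map_prod]
    apply Finset.prod_eq_one
    intro j _
    simp [qVar, zero_pow (show k ≠ 0 by omega)]
  rw [this]
  exact isUnit_one

/-- A cylindric partition of profile `c = (c_i)_{i ∈ ℤ/rℤ}`: a family of partitions
`λ^{(i)}`, `i ∈ ℤ/rℤ`, with `λ^{(i)}_j ≥ λ^{(i+1)}_{j + c_{i+1}}` for all `i` and `j ≥ 1`.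
A partition `μ₁ ≥ μ₂ ≥ ⋯`, with `μ_k = 0` for `k` larger than its length, is given as a finitely
supported antitone function, whose value at `j` is the part `μ_{j+1}`. -/
@[ext]
structure CylindricPartition {r : ℕ} (c : ZMod r → ℕ) where
  /-- `part i j` is `λ^{(i)}_{j+1}`. -/
  part : ZMod r → ℕ →₀ ℕ
  antitone_part : ∀ i, Antitone (part i)
  cylindric : ∀ i j, part (i + 1) (j + c (i + 1)) ≤ part i j

/-- `max(λ)`: the largest part occurring in any of the `λ^{(i)}` (and `0` if there is none). -/
def CylindricPartition.max {r : ℕ} [NeZero r] {c : ZMod r → ℕ} (l : CylindricPartition c) : ℕ :=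
  Finset.univ.sup fun i => (l.part i).support.sup (l.part i)

/-- `|λ|`: the sum of all parts of all the `λ^{(i)}`. -/
def CylindricPartition.size {r : ℕ} [NeZero r] {c : ZMod r → ℕ} (l : CylindricPartition c) : ℕ :=
  ∑ i, (l.part i).sum fun _ m => m

/-- The monomial `x^{max(λ)} q^{|λ|}`. -/
noncomputable def CylindricPartition.weight {r : ℕ} [NeZero r] {c : ZMod r → ℕ}
    (l : CylindricPartition c) : XQSeries :=
  xVar ^ l.max * qVar' ^ l.size

/-- `F_c(x, q) = ∑_λ x^{max(λ)} q^{|λ|}`, over all cylindric partitions `λ` of profile `c`. -/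
noncomputable def cylF {r : ℕ} [NeZero r] (c : ZMod r → ℕ) : XQSeries :=
  ∑' l : CylindricPartition c, l.weight

/-- `G_c(x, q) = (xq; q)_∞ F_c(x, q)`. -/
noncomputable def cylG {r : ℕ} [NeZero r] (c : ZMod r → ℕ) : XQSeries :=
  qPochInf (xVar * qVar') qVar' * cylF c

/-- The profile `(1, 1, 1)`, indexed by `ℤ/3ℤ`. -/
def profile111 : ZMod 3 → ℕ := fun _ => 1

/-- The coefficient
`q^{a²+b²+3c²+3d²+2ab+3ac+3ad+3bc+3bd+6cd} / ((q;q)_a (q;q)_b (q³;q³)_c (q³;q³)_d)` in `ℤ⟦q⟧`. -/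
noncomputable def agCoeff (a b c d : ℕ) : QSeries :=
  qVar ^ (a ^ 2 + b ^ 2 + 3 * c ^ 2 + 3 * d ^ 2 + 2 * a * b + 3 * a * c + 3 * a * d
      + 3 * b * c + 3 * b * d + 6 * c * d) *
    Ring.inverse (qPoch qVar qVar a * qPoch qVar qVar b *
      qPoch (qVar ^ 3) (qVar ^ 3) c * qPoch (qVar ^ 3) (qVar ^ 3) d)

/-!
Both sides solve the same linear `q`-difference system in `x`, which has only one solution with
constant term `1`. Write `A` and `D` for the series `G_c` of the profiles `(1, 1, 1)` and
`(3, 0, 0)`. The system is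

* `A(x) = (1 + 2xq + 2xq² + x²q³) A(xq³) + 3xq³(1 + xq) D(xq³)`,
* `D(x) = (1 + xq²) A(xq³) + 2xq³ D(xq³)`,

and comparing coefficients of `x ^ n` shows that it determines `A` from `A_0`
(`qShift_system_unique`).

*Cylindric partitions.* Among the cylindric partitions of profile `c` with all parts at most `n`,
consider those with `λ^{(i)}_1 = n` for all `i` in a set `J` of indices with `c_i ≠ 0`. Deleting
these first parts is a bijection onto the cylindric partitions of profile `c(J)` with parts at most
`n` (`CylindricPartition.removeEquiv`). If some part is equal to `n`, then some `λ^{(i)}_1` with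
`c_i ≠ 0` is, so inclusion–exclusion over `J` relates the bounds `n - 1` and `n`
(`CylindricPartition.sum_powerset_boundedSeries`). Multiplying by `(xq; q)_∞` gives the
Corteel–Welsh functional equations `cylG_eq_sum`. At level three they form a closed system in the
four profiles `(1, 1, 1)`, `(2, 1, 0)`, `(2, 0, 1)`, `(3, 0, 0)` up to rotation, and eliminating the
middle two gives the system above (`cylG_111_eq`, `cylG_300_eq`).

*Quadruple sums.* Twist the quadruple sum by `q^{αa + βb + γc + δd}`. Multiplying its terms by
`1 - q^a`, `1 - q^b`, `1 - q^{3c}` or `1 - q^{3d}` cancels a factor of the denominator and lowers an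
index; this gives four contiguous relations (`agSum_contiguous_a` and its companions). The untwisted
sum for `A` and the sum twisted by `q^{a + 2b + 3c + 3d}` for `D` satisfy the system, as explicit
linear combinations of contiguous relations (`agSum_0000_eq`, `agSum_1233_eq`).
-/

/-! ### Convergence in `ℤ⟦q⟧⟦x⟧` -/

theorem QSeries.summable_of_finite_coeff {ι : Type*} {f : ι → QSeries}
    (h : ∀ m, {i | coeff m (f i) ≠ 0}.Finite) : Summable f := by
  rw [PowerSeries.WithPiTopology.summable_iff_summable_coeff]
  exact fun m => summable_of_hasFiniteSupport (h m)

theorem XQSeries.summable_of_finite_coeff {ι : Type*} {f : ι → XQSeries}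
    (h : ∀ n m, {i | coeff m (coeff n (f i)) ≠ 0}.Finite) : Summable f := by
  rw [PowerSeries.WithPiTopology.summable_iff_summable_coeff]
  exact fun n => QSeries.summable_of_finite_coeff (h n)

theorem XQSeries.coeff_tsum {ι : Type*} {f : ι → XQSeries} (hf : Summable f) (n : ℕ) :
    coeff n (∑' i, f i) = ∑' i, coeff n (f i) :=
  (((PowerSeries.WithPiTopology.hasSum_iff_hasSum_coeff _).mp hf.hasSum n).tsum_eq).symm

theorem coeff_xVar_pow_mul_C (s n : ℕ) (a : QSeries) :
    coeff n (xVar ^ s * C a : XQSeries) = if n = s then a else 0 := by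
  rw [xVar, coeff_X_pow_mul']
  split_ifs with h1 h2 h2
  · subst h2; simp
  · rw [coeff_C, if_neg (by omega)]
  · omega
  · rfl

/-! ### The substitution `x ↦ x q ^ k` -/

/-- The ring endomorphism `f(x) ↦ f(x q ^ k)` of `ℤ⟦q⟧⟦x⟧`. -/
noncomputable def qShift (k : ℕ) : XQSeries →+* XQSeries :=
  rescale (qVar ^ k)

theorem coeff_qShift (k n : ℕ) (f : XQSeries) :
    coeff n (qShift k f) = qVar ^ (k * n) * coeff n f := by
  rw [qShift, coeff_rescale, pow_mul]

theorem qShift_C (k : ℕ) (a : QSeries) : qShift k (C a) = C a := by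
  ext1 n
  rw [coeff_qShift, coeff_C]
  split_ifs with h <;> simp [h]

theorem qShift_qVar' (k : ℕ) : qShift k qVar' = qVar' := qShift_C k _

theorem qShift_xVar (k : ℕ) : qShift k xVar = xVar * qVar' ^ k := by
  rw [qShift, xVar, rescale_X, qVar', map_pow, mul_comm]

theorem qShift_qShift (j k : ℕ) (f : XQSeries) : qShift j (qShift k f) = qShift (j + k) f := by
  ext1 n
  simp only [coeff_qShift]
  ring

theorem qShift_zero (f : XQSeries) : qShift 0 f = f := by
  simp [qShift]

theorem continuous_qShift (k : ℕ) : Continuous (qShift k) := by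
  rw [continuous_iff_continuousAt]
  intro f
  rw [ContinuousAt, PowerSeries.WithPiTopology.tendsto_iff_coeff_tendsto]
  intro n
  simp only [coeff_qShift]
  exact ((PowerSeries.WithPiTopology.continuous_coeff QSeries n).tendsto f).const_mul _

/-! ### The product `(xq; q)_∞` -/

/-- In the expansion of the product over finite subsets `t` of `ℕ`, the term of `t` has degree
`∑ j ∈ t, (j + 1)` in `q`, so that only finitely many `t` contribute to a given coefficient. -/
theorem multipliable_one_sub_x_mul_q_pow :
    Multipliable (fun j : ℕ => (1 - xVar * qVar' * qVar' ^ j : XQSeries)) := by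
  have h : Summable (fun t : Finset ℕ => ∏ j ∈ t, (-(xVar * qVar' * qVar' ^ j) : XQSeries)) := by
    have key : ∀ t : Finset ℕ, ∏ j ∈ t, (-(xVar * qVar' * qVar' ^ j) : XQSeries) =
        xVar ^ t.card * C ((-1) ^ t.card * qVar ^ (∑ j ∈ t, (j + 1))) := by
      intro t
      rw [← Finset.prod_pow_eq_pow_sum, map_mul, map_pow, map_prod, ← Finset.prod_const,
        ← Finset.prod_const, ← Finset.prod_mul_distrib, ← Finset.prod_mul_distrib]
      refine Finset.prod_congr rfl fun j _ => ?_
      simp only [qVar', map_pow, map_neg, map_one]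
      ring
    refine XQSeries.summable_of_finite_coeff fun n m => ?_
    refine (Finset.finite_toSet (Finset.range m).powerset).subset fun t ht => ?_
    have h2 : ∑ j ∈ t, (j + 1) = m := by
      by_contra hne
      apply ht
      rw [key, coeff_xVar_pow_mul_C]
      split_ifs
      · have : ((-1) ^ t.card : QSeries) = C ((-1) ^ t.card) := by simp
        rw [this, coeff_C_mul, qVar, coeff_X_pow, if_neg (Ne.symm hne), mul_zero]
      · simp
    simp only [Finset.coe_powerset, Set.mem_preimage, Set.mem_powerset_iff, Finset.coe_subset]
    intro j hj
    have := Finset.single_le_sum (f := fun j => j + 1) (fun _ _ => Nat.zero_le _) hj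
    rw [Finset.mem_range]
    omega
  simpa only [sub_eq_add_neg] using multipliable_one_add_of_summable_prod h

theorem qShift_one_sub_x_mul_q_pow (j : ℕ) :
    qShift 1 (1 - xVar * qVar' * qVar' ^ j) = 1 - xVar * qVar' * qVar' ^ (j + 1) := by
  rw [map_sub, map_one, map_mul, map_mul, map_pow, qShift_xVar, qShift_qVar']
  ring

theorem qPochInf_eq_mul_qShift :
    qPochInf (xVar * qVar') qVar' =
      (1 - xVar * qVar') * qShift 1 (qPochInf (xVar * qVar') qVar') := by
  have h := multipliable_one_sub_x_mul_q_pow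
  have h2 : qShift 1 (qPochInf (xVar * qVar') qVar') =
      ∏' j : ℕ, (1 - xVar * qVar' * qVar' ^ (j + 1)) := by
    rw [qPochInf, h.map_tprod (qShift 1) (continuous_qShift 1)]
    exact tprod_congr qShift_one_sub_x_mul_q_pow
  have h' : Multipliable fun j : ℕ => (1 - xVar * qVar' * qVar' ^ (j + 1) : XQSeries) := by
    have := h.map (qShift 1) (continuous_qShift 1)
    exact this.congr qShift_one_sub_x_mul_q_pow
  have h3 := tprod_eq_zero_mul' (f := fun j : ℕ => (1 - xVar * qVar' * qVar' ^ j : XQSeries)) h'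
  rw [h2, qPochInf, h3, pow_zero, mul_one]

theorem coeff_zero_qPochInf : coeff 0 (qPochInf (xVar * qVar') qVar') = 1 := by
  have h := multipliable_one_sub_x_mul_q_pow.map_tprod
    (constantCoeff (R := QSeries)) (PowerSeries.WithPiTopology.continuous_constantCoeff QSeries)
  rw [coeff_zero_eq_constantCoeff_apply, qPochInf, h]
  simp [xVar]

/-! ### The quadruple sums -/

/-- The term of the quadruple sum with indices `p = (a, b, c, d)`, twisted by the linear exponent
`α a + β b + γ c + δ d` of `q`. -/
noncomputable def agTerm (α β γ δ : ℕ) (p : ℕ × ℕ × ℕ × ℕ) : XQSeries :=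
  xVar ^ (p.1 + p.2.1 + p.2.2.1 + 2 * p.2.2.2) *
    C (qVar ^ (α * p.1 + β * p.2.1 + γ * p.2.2.1 + δ * p.2.2.2) *
      agCoeff p.1 p.2.1 p.2.2.1 p.2.2.2)

/-- The quadruple sum twisted by the linear exponent `α a + β b + γ c + δ d` of `q`. -/
noncomputable def agSum (α β γ δ : ℕ) : XQSeries :=
  ∑' p, agTerm α β γ δ p

theorem summable_agTerm (α β γ δ : ℕ) : Summable (agTerm α β γ δ) := by
  refine XQSeries.summable_of_finite_coeff fun n m => ?_
  refine (Finset.finite_toSet (Finset.range (n + 1) ×ˢ Finset.range (n + 1) ×ˢ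
    Finset.range (n + 1) ×ˢ Finset.range (n + 1))).subset fun p hp => ?_
  have h : n = p.1 + p.2.1 + p.2.2.1 + 2 * p.2.2.2 := by
    by_contra hne
    apply hp
    rw [agTerm, coeff_xVar_pow_mul_C, if_neg hne, map_zero]
  simp only [Finset.coe_product, Set.mem_prod, Finset.coe_range, Set.mem_Iio]
  omega

theorem qShift_agSum (k α β γ δ : ℕ) :
    qShift k (agSum α β γ δ) = agSum (α + k) (β + k) (γ + k) (δ + 2 * k) := by
  rw [agSum, (summable_agTerm α β γ δ).map_tsum (qShift k) (continuous_qShift k)]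
  refine tsum_congr fun p => ?_
  rw [agTerm, agTerm, map_mul, map_pow, qShift_xVar, qShift_C, qVar']
  simp only [map_mul, map_pow]
  ring

theorem coeff_zero_agSum (α β γ δ : ℕ) : coeff 0 (agSum α β γ δ) = 1 := by
  rw [agSum, XQSeries.coeff_tsum (summable_agTerm α β γ δ), tsum_eq_single (0, 0, 0, 0)]
  · simp [agTerm, agCoeff, qPoch]
  · rintro ⟨a, b, c, d⟩ hp
    rw [agTerm, coeff_xVar_pow_mul_C, if_neg]
    intro h
    apply hp
    dsimp only at h
    simp only [Prod.mk.injEq]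
    omega

theorem qPoch_succ {A : Type*} [CommRing A] (a t : A) (n : ℕ) :
    qPoch a t (n + 1) = qPoch a t n * (1 - a * t ^ n) :=
  Finset.prod_range_succ _ n

theorem isUnit_qPoch_qVar (n : ℕ) : IsUnit (qPoch qVar qVar n) := by
  simpa using isUnit_qPoch 1 n le_rfl

theorem isUnit_qPoch_qVar_cube (n : ℕ) : IsUnit (qPoch (qVar ^ 3) (qVar ^ 3) n) :=
  isUnit_qPoch 3 n (by norm_num)

theorem Ring.mul_inverse_eq_of_eq_mul {A : Type*} [CommRing A] {u v w : A} (hu : IsUnit u)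
    (hv : IsUnit v) (h : v = u * w) : w * Ring.inverse v = Ring.inverse u := by
  apply hu.mul_left_cancel
  rw [← mul_assoc, ← h, Ring.mul_inverse_cancel _ hu, Ring.mul_inverse_cancel _ hv]

theorem isUnit_agDenom (a b c d : ℕ) :
    IsUnit (qPoch qVar qVar a * qPoch qVar qVar b *
      qPoch (qVar ^ 3) (qVar ^ 3) c * qPoch (qVar ^ 3) (qVar ^ 3) d) :=
  (((isUnit_qPoch_qVar a).mul (isUnit_qPoch_qVar b)).mul (isUnit_qPoch_qVar_cube c)).mul
    (isUnit_qPoch_qVar_cube d)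

theorem agCoeff_swap (a b c d : ℕ) : agCoeff a b c d = agCoeff b a c d := by
  rw [agCoeff, agCoeff, mul_comm (qPoch qVar qVar a)]
  congr 2
  ring

theorem one_sub_mul_agCoeff_succ_a (a b c d : ℕ) :
    (1 - qVar ^ (a + 1)) * agCoeff (a + 1) b c d =
      qVar ^ (2 * a + 2 * b + 3 * c + 3 * d + 1) * agCoeff a b c d := by
  have h := Ring.mul_inverse_eq_of_eq_mul (w := 1 - qVar ^ (a + 1)) (isUnit_agDenom a b c d)
    (isUnit_agDenom (a + 1) b c d) (by rw [qPoch_succ]; ring)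
  rw [agCoeff, agCoeff, ← h]
  ring

theorem one_sub_mul_agCoeff_succ_c (a b c d : ℕ) :
    (1 - qVar ^ (3 * (c + 1))) * agCoeff a b (c + 1) d =
      qVar ^ (3 * a + 3 * b + 6 * c + 6 * d + 3) * agCoeff a b c d := by
  have h := Ring.mul_inverse_eq_of_eq_mul (w := 1 - qVar ^ (3 * (c + 1))) (isUnit_agDenom a b c d)
    (isUnit_agDenom a b (c + 1) d) (by rw [qPoch_succ]; ring)
  rw [agCoeff, agCoeff, ← h]
  ring

theorem one_sub_mul_agCoeff_succ_d (a b c d : ℕ) :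
    (1 - qVar ^ (3 * (d + 1))) * agCoeff a b c (d + 1) =
      qVar ^ (3 * a + 3 * b + 6 * c + 6 * d + 3) * agCoeff a b c d := by
  have h := Ring.mul_inverse_eq_of_eq_mul (w := 1 - qVar ^ (3 * (d + 1))) (isUnit_agDenom a b c d)
    (isUnit_agDenom a b c (d + 1)) (by rw [qPoch_succ]; ring)
  rw [agCoeff, agCoeff, ← h]
  ring

theorem agSum_swap (α β γ δ : ℕ) : agSum α β γ δ = agSum β α γ δ := by
  let e : ℕ × ℕ × ℕ × ℕ ≃ ℕ × ℕ × ℕ × ℕ :=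
    { toFun := fun p => (p.2.1, p.1, p.2.2)
      invFun := fun p => (p.2.1, p.1, p.2.2)
      left_inv := fun _ => rfl
      right_inv := fun _ => rfl }
  rw [agSum, agSum, ← e.tsum_eq]
  refine tsum_congr fun p => ?_
  simp only [agTerm, e, Equiv.coe_fn_mk]
  rw [agCoeff_swap p.2.1 p.1, add_comm p.2.1 p.1, add_comm (α * p.2.1)]

/-- A termwise comparison along an injective reindexing `g`: the differences of the terms of the
first two sums vanish off the range of `g`, and on it are proportional to the terms of the third. -/
theorem agSum_sub_agSum {α β γ δ α' β' γ' δ' α'' β'' γ'' δ'' : ℕ} {K : XQSeries}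
    {g : ℕ × ℕ × ℕ × ℕ → ℕ × ℕ × ℕ × ℕ} (hg : Function.Injective g)
    (h0 : ∀ p, p ∉ Set.range g → agTerm α β γ δ p = agTerm α' β' γ' δ' p)
    (h1 : ∀ p, agTerm α β γ δ (g p) - agTerm α' β' γ' δ' (g p) = K * agTerm α'' β'' γ'' δ'' p) :
    agSum α β γ δ - agSum α' β' γ' δ' = K * agSum α'' β'' γ'' δ'' := by
  rw [agSum, agSum, agSum,
    ← (summable_agTerm α β γ δ).tsum_sub (summable_agTerm α' β' γ' δ'),
    ← (summable_agTerm α'' β'' γ'' δ'').tsum_mul_left K, ← tsum_congr h1]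
  refine (hg.tsum_eq ?_).symm
  intro p hp
  by_contra hne
  exact hp (sub_eq_zero.mpr (h0 p hne))

theorem agSum_contiguous_a (α β γ δ : ℕ) :
    agSum α β γ δ - agSum (α + 1) β γ δ =
      xVar * qVar' ^ (α + 1) * agSum (α + 2) (β + 2) (γ + 3) (δ + 3) := by
  refine agSum_sub_agSum (g := fun p => (p.1 + 1, p.2.1, p.2.2.1, p.2.2.2)) ?_ ?_ ?_
  · rintro ⟨a, b, c, d⟩ ⟨a', b', c', d'⟩ h
    simpa using h
  · rintro ⟨_ | a, b, c, d⟩ h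
    · simp [agTerm]
    · exact absurd ⟨(a, b, c, d), rfl⟩ h
  · rintro ⟨a, b, c, d⟩
    have h := congrArg (C (R := QSeries)) (one_sub_mul_agCoeff_succ_a a b c d)
    simp only [agTerm, map_mul, map_pow, map_sub, map_one, ← qVar'.eq_1] at h ⊢
    linear_combination xVar ^ (a + 1 + b + c + 2 * d) *
      qVar' ^ (α * (a + 1) + β * b + γ * c + δ * d) * h

theorem agSum_contiguous_b (α β γ δ : ℕ) :
    agSum α β γ δ - agSum α (β + 1) γ δ =
      xVar * qVar' ^ (β + 1) * agSum (α + 2) (β + 2) (γ + 3) (δ + 3) := by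
  rw [agSum_swap α β, agSum_swap α, agSum_swap (α + 2)]
  exact agSum_contiguous_a β α γ δ

theorem agSum_contiguous_c (α β γ δ : ℕ) :
    agSum α β γ δ - agSum α β (γ + 3) δ =
      xVar * qVar' ^ (γ + 3) * agSum (α + 3) (β + 3) (γ + 6) (δ + 6) := by
  refine agSum_sub_agSum (g := fun p => (p.1, p.2.1, p.2.2.1 + 1, p.2.2.2)) ?_ ?_ ?_
  · rintro ⟨a, b, c, d⟩ ⟨a', b', c', d'⟩ h
    simpa using h
  · rintro ⟨a, b, _ | c, d⟩ h
    · simp [agTerm]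
    · exact absurd ⟨(a, b, c, d), rfl⟩ h
  · rintro ⟨a, b, c, d⟩
    have h := congrArg (C (R := QSeries)) (one_sub_mul_agCoeff_succ_c a b c d)
    simp only [agTerm, map_mul, map_pow, map_sub, map_one, ← qVar'.eq_1] at h ⊢
    linear_combination xVar ^ (a + b + (c + 1) + 2 * d) *
      qVar' ^ (α * a + β * b + γ * (c + 1) + δ * d) * h

theorem agSum_contiguous_d (α β γ δ : ℕ) :
    agSum α β γ δ - agSum α β γ (δ + 3) =
      xVar ^ 2 * qVar' ^ (δ + 3) * agSum (α + 3) (β + 3) (γ + 6) (δ + 6) := by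
  refine agSum_sub_agSum (g := fun p => (p.1, p.2.1, p.2.2.1, p.2.2.2 + 1)) ?_ ?_ ?_
  · rintro ⟨a, b, c, d⟩ ⟨a', b', c', d'⟩ h
    simpa using h
  · rintro ⟨a, b, c, _ | d⟩ h
    · simp [agTerm]
    · exact absurd ⟨(a, b, c, d), rfl⟩ h
  · rintro ⟨a, b, c, d⟩
    have h := congrArg (C (R := QSeries)) (one_sub_mul_agCoeff_succ_d a b c d)
    simp only [agTerm, map_mul, map_pow, map_sub, map_one, ← qVar'.eq_1] at h ⊢
    linear_combination xVar ^ (a + b + c + 2 * (d + 1)) *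
      qVar' ^ (α * a + β * b + γ * c + δ * (d + 1)) * h

/-- The `q`-difference equation of the sum with linear exponent `a + 2b + 3c + 3d`. The coefficients
of the linear combination come from solving a linear system over `ℚ(x, q)`, with one unknown for
each contiguous relation among the sums `agSum α β γ δ` with `α, β ≤ 5` and `γ, δ ≤ 9`. -/
theorem agSum_1233_eq :
    agSum 1 2 3 3 =
      (1 + xVar * qVar' ^ 2) * qShift 3 (agSum 0 0 0 0) +
        2 * (xVar * qVar' ^ 3) * qShift 3 (agSum 1 2 3 3) := by
  rw [qShift_agSum, qShift_agSum]
  have a1 := agSum_contiguous_a 1 2 3 3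
  have a2 := agSum_contiguous_c 1 2 0 3
  have a3 := agSum_contiguous_b 3 3 6 6
  have a4 := agSum_contiguous_b 0 1 0 3
  have a5 := agSum_contiguous_b 2 3 3 6
  have a6 := agSum_contiguous_a 0 2 0 3
  have a7 := agSum_contiguous_a 2 3 3 6
  have a8 := agSum_contiguous_b 2 2 3 6
  have a9 := agSum_contiguous_d 2 2 3 3
  have a10 := agSum_contiguous_c 1 1 0 3
  have a11 := agSum_contiguous_b 1 1 3 3
  have a12 := agSum_contiguous_a 0 1 0 3
  norm_num only at *
  linear_combination a1 + a2 - xVar * qVar' ^ 2 * a3 + a4 - xVar * qVar' * a5 + a6 +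
    (1 + xVar * qVar' ^ 2) * a7 + a8 + a9 - a10 - a11 - a12

/-- The `q`-difference equation of the untwisted sum, by a linear combination of contiguous
relations found in the same way. -/
theorem agSum_0000_eq :
    agSum 0 0 0 0 =
      (1 + 2 * (xVar * qVar') + 2 * (xVar * qVar' ^ 2) + xVar ^ 2 * qVar' ^ 3) *
          qShift 3 (agSum 0 0 0 0) +
        3 * (xVar * qVar' ^ 3) * (1 + xVar * qVar') * qShift 3 (agSum 1 2 3 3) := by
  rw [qShift_agSum, qShift_agSum]
  have b1 := agSum_contiguous_b 1 1 3 3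
  have b2 := agSum_contiguous_b 0 1 0 3
  have b3 := agSum_contiguous_a 0 1 0 3
  have b4 := agSum_contiguous_a 2 3 3 6
  have b5 := agSum_contiguous_b 2 3 3 6
  have b6 := agSum_contiguous_a 0 2 0 3
  have b7 := agSum_contiguous_c 1 2 0 3
  have b8 := agSum_contiguous_a 1 2 3 3
  have b9 := agSum_contiguous_b 2 2 3 6
  have b10 := agSum_contiguous_c 1 1 0 3
  have b11 := agSum_contiguous_b 0 0 0 3
  have b12 := agSum_contiguous_d 0 0 0 0
  have b13 := agSum_contiguous_d 2 2 3 3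
  have b14 := agSum_contiguous_b 3 3 6 6
  norm_num only at *
  linear_combination -(1 + xVar * qVar') * b1 + (2 + xVar * qVar') * b2 -
    (1 + xVar * qVar') * b3 +
    (1 + 2 * (xVar * qVar') + 2 * (xVar * qVar' ^ 2) + xVar ^ 2 * qVar' ^ 3) * b4 -
    (2 * (xVar * qVar') + xVar ^ 2 * qVar' ^ 2) * b5 + (2 + xVar * qVar') * b6 +
    (2 + xVar * qVar') * b7 + b8 + (1 + xVar * qVar') * b9 - (1 + xVar * qVar') * b10 + b11 +
    b12 + b13 - xVar * qVar' ^ 2 * b14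

/-! ### Finiteness of the set of cylindric partitions of bounded size -/

namespace CylindricPartition

variable {r : ℕ} [NeZero r] {c : ZMod r → ℕ}

theorem max_le_iff_part_zero_le (l : CylindricPartition c) (n : ℕ) :
    l.max ≤ n ↔ ∀ i, l.part i 0 ≤ n := by
  simp only [CylindricPartition.max, Finset.sup_le_iff, Finset.mem_univ, true_imp_iff]
  refine forall_congr' fun i => ⟨fun h => ?_, fun h j _ => ?_⟩
  · by_cases h0 : l.part i 0 = 0
    · omega
    · exact h 0 (Finsupp.mem_support_iff.mpr h0)
  · exact (l.antitone_part i (Nat.zero_le j)).trans h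

theorem sum_part_le_size (l : CylindricPartition c) (i : ZMod r) :
    ∑ j ∈ (l.part i).support, l.part i j ≤ l.size :=
  Finset.single_le_sum (f := fun i => (l.part i).sum fun _ m => m) (fun _ _ => Nat.zero_le _)
    (Finset.mem_univ i)

theorem part_le_size (l : CylindricPartition c) (i : ZMod r) (j : ℕ) : l.part i j ≤ l.size := by
  by_cases h : l.part i j = 0
  · omega
  · exact (Finset.single_le_sum (fun _ _ => Nat.zero_le _)
      (Finsupp.mem_support_iff.mpr h)).trans (l.sum_part_le_size i)

theorem lt_size_of_part_ne_zero (l : CylindricPartition c) {i : ZMod r} {j : ℕ}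
    (h : l.part i j ≠ 0) : j < l.size := by
  have hsub : Finset.range (j + 1) ⊆ (l.part i).support := by
    intro k hk
    have := l.antitone_part i (Nat.lt_succ_iff.mp (Finset.mem_range.mp hk))
    rw [Finsupp.mem_support_iff]
    omega
  have h1 := Finset.card_le_card hsub
  have h2 : (l.part i).support.card ≤ ∑ j ∈ (l.part i).support, l.part i j := by
    rw [Finset.card_eq_sum_ones]
    exact Finset.sum_le_sum fun k hk => Nat.one_le_iff_ne_zero.mpr (Finsupp.mem_support_iff.mp hk)
  have h3 := l.sum_part_le_size i
  rw [Finset.card_range] at h1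
  omega

theorem finite_size_le (c : ZMod r → ℕ) (m : ℕ) :
    {l : CylindricPartition c | l.size ≤ m}.Finite := by
  refine Set.Finite.of_finite_image (f := fun l (i : ZMod r) (j : Fin m) =>
    Fin.ofNat (m + 1) (l.part i j)) (Set.toFinite _) ?_
  intro l hl l' hl' h
  rw [Set.mem_ofPred_eq] at hl hl'
  ext i j
  by_cases hj : j < m
  · have h1 := congrArg Fin.val (congrFun (congrFun h i) ⟨j, hj⟩)
    have h2 := l.part_le_size i j
    have h3 := l'.part_le_size i j
    simp only [Fin.val_ofNat] at h1
    rwa [Nat.mod_eq_of_lt (by omega), Nat.mod_eq_of_lt (by omega)] at h1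
  · have h1 : l.part i j = 0 := by
      by_contra hne
      have := l.lt_size_of_part_ne_zero hne
      omega
    have h2 : l'.part i j = 0 := by
      by_contra hne
      have := l'.lt_size_of_part_ne_zero hne
      omega
    rw [h1, h2]

theorem summable_qVar_pow_size_mul (a : CylindricPartition c → QSeries) :
    Summable fun l : CylindricPartition c => qVar ^ l.size * a l := by
  refine QSeries.summable_of_finite_coeff fun m => (finite_size_le c m).subset fun l hl => ?_
  by_contra h
  apply hl
  rw [qVar, coeff_X_pow_mul']
  exact if_neg h

/-! ### Removing the largest parts -/

/-- The partition obtained by prepending the part `n`. -/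
noncomputable def consPart (n : ℕ) (f : ℕ →₀ ℕ) : ℕ →₀ ℕ :=
  Finsupp.single 0 n + f.embDomain ⟨Nat.succ, Nat.succ_injective⟩

/-- The partition obtained by deleting the first part. -/
noncomputable def tailPart (f : ℕ →₀ ℕ) : ℕ →₀ ℕ :=
  f.comapDomain Nat.succ Nat.succ_injective.injOn

theorem consPart_zero (n : ℕ) (f : ℕ →₀ ℕ) : consPart n f 0 = n := by
  rw [consPart, Finsupp.add_apply, Finsupp.single_eq_same,
    Finsupp.embDomain_of_notMem_range, add_zero]
  rintro ⟨j, hj⟩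
  exact Nat.succ_ne_zero j hj

theorem consPart_succ (n : ℕ) (f : ℕ →₀ ℕ) (j : ℕ) : consPart n f (j + 1) = f j := by
  rw [consPart, Finsupp.add_apply, Finsupp.single_eq_of_ne (by omega), zero_add]
  exact Finsupp.embDomain_apply_self ⟨Nat.succ, Nat.succ_injective⟩ f j

theorem tailPart_apply (f : ℕ →₀ ℕ) (j : ℕ) : tailPart f j = f (j + 1) := rfl

theorem sum_consPart (n : ℕ) (f : ℕ →₀ ℕ) :
    ((consPart n f).sum fun _ m => m) = n + f.sum fun _ m => m := by
  rw [consPart, Finsupp.sum_add_index' (fun _ => rfl) (fun _ _ _ => rfl),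
    Finsupp.sum_single_index rfl, Finsupp.sum_embDomain]

end CylindricPartition

/-- The profile `c(J)` of a cylindric partition of profile `c` from which the first parts of the
`λ^{(i)}`, `i ∈ J`, have been removed. The subtraction does not truncate when `c i ≠ 0` on `J`. -/
def removalProfile {r : ℕ} (c : ZMod r → ℕ) (J : Finset (ZMod r)) (i : ZMod r) : ℕ :=
  c i + (if i - 1 ∈ J then 1 else 0) - (if i ∈ J then 1 else 0)

namespace CylindricPartition

variable {r : ℕ} [NeZero r] {c : ZMod r → ℕ}

/-- Deleting the first parts of the `λ^{(i)}`, `i ∈ J`, when all of these equal the bound `n` on the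
parts, is a bijection onto the cylindric partitions of profile `c(J)` with parts at most `n`. -/
noncomputable def removeEquiv (n : ℕ) {J : Finset (ZMod r)} (hJ : ∀ i ∈ J, c i ≠ 0) :
    {l : CylindricPartition c | (∀ i, l.part i 0 ≤ n) ∧ ∀ i ∈ J, l.part i 0 = n} ≃
      {l : CylindricPartition (removalProfile c J) | ∀ i, l.part i 0 ≤ n} where
  toFun l :=
    ⟨{ part := fun i => if i ∈ J then tailPart (l.1.part i) else l.1.part i
       antitone_part := by
        intro i
        split_ifs
        · exact fun j k h => l.1.antitone_part i (Nat.succ_le_succ h)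
        · exact l.1.antitone_part i
       cylindric := by
        intro i j
        have hc := hJ (i + 1)
        have h0 := l.1.cylindric i j
        have h1 := l.1.cylindric i (j + 1)
        rw [removalProfile, add_sub_cancel_right]
        split_ifs with ha hb hb
        · rw [tailPart_apply, tailPart_apply]
          convert h1 using 2
          omega
        · rw [tailPart_apply]
          convert h0 using 2
          have := hc ha
          omega
        · rw [tailPart_apply]
          convert h1 using 2
          omega
        · exact h0 },
      by
        intro i
        dsimp only
        split_ifs
        · exact (l.1.antitone_part i (Nat.zero_le _)).trans (l.2.1 i)
        · exact l.2.1 i⟩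
  invFun l :=
    ⟨{ part := fun i => if i ∈ J then consPart n (l.1.part i) else l.1.part i
       antitone_part := by
        intro i
        split_ifs
        · refine antitone_nat_of_succ_le fun j => ?_
          rcases j with _ | j
          · rw [consPart_zero, consPart_succ]
            exact l.2 i
          · rw [consPart_succ, consPart_succ]
            exact l.1.antitone_part i (Nat.le_succ j)
        · exact l.1.antitone_part i
       cylindric := by
        intro i j
        have hc := hJ (i + 1)
        have hn : ∀ k, l.1.part (i + 1) k ≤ n := fun k =>
          (l.1.antitone_part (i + 1) (Nat.zero_le _)).trans (l.2 (i + 1))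
        have h0 := l.1.cylindric i
        simp only [removalProfile, add_sub_cancel_right] at h0
        split_ifs at h0 ⊢ with ha hb hb
        · obtain ⟨m, hm⟩ := Nat.exists_eq_succ_of_ne_zero (hc ha)
          rcases j with _ | j
          · rw [consPart_zero, hm, zero_add, consPart_succ]
            exact hn m
          · rw [consPart_succ, add_right_comm, consPart_succ]
            exact h0 j
        · obtain ⟨m, hm⟩ := Nat.exists_eq_succ_of_ne_zero (hc ha)
          rw [hm, Nat.succ_eq_add_one, ← add_assoc, consPart_succ]
          have := h0 j
          rwa [hm] at this
        · rcases j with _ | j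
          · rw [consPart_zero]
            exact hn _
          · rw [consPart_succ]
            convert h0 j using 2
            omega
        · exact h0 j },
      by
        refine ⟨fun i => ?_, fun i hi => ?_⟩
        · dsimp only
          split_ifs
          · rw [consPart_zero]
          · exact l.2 i
        · dsimp only
          rw [if_pos hi, consPart_zero]⟩
  left_inv := by
    intro l
    ext i j
    dsimp only
    split_ifs with h
    · rcases j with _ | j
      · rw [consPart_zero, l.2.2 i h]
      · rw [consPart_succ, tailPart_apply]
    · rfl
  right_inv := by
    intro l
    ext i j
    dsimp only
    split_ifs with h
    · rw [tailPart_apply, consPart_succ]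
    · rfl

theorem size_removeEquiv_symm (n : ℕ) {J : Finset (ZMod r)} (hJ : ∀ i ∈ J, c i ≠ 0)
    (l : {l : CylindricPartition (removalProfile c J) | ∀ i, l.part i 0 ≤ n}) :
    ((removeEquiv n hJ).symm l).1.size = n * J.card + l.1.size := by
  have h : ∀ i, ((((removeEquiv n hJ).symm l).1.part i).sum fun _ m => m) =
      (if i ∈ J then n else 0) + (l.1.part i).sum fun _ m => m := by
    intro i
    change ((if i ∈ J then consPart n (l.1.part i) else l.1.part i).sum fun _ m => m) = _
    split_ifs
    · rw [sum_consPart]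
    · rw [zero_add]
  rw [size, Finset.sum_congr rfl fun i _ => h i, Finset.sum_add_distrib, size]
  simp [mul_comm]

/-- A position of largest part can be chosen at an index with `c i ≠ 0`: otherwise the cylindric
condition at `j` forces the previous first part to be largest as well, all the way around. -/
theorem exists_ne_zero_of_part_zero_eq (hc : c ≠ 0) {n : ℕ} (l : CylindricPartition c)
    (hl : ∀ i, l.part i 0 ≤ n) {i : ZMod r} (hi : l.part i 0 = n) :
    ∃ i, c i ≠ 0 ∧ l.part i 0 = n := by
  by_contra! hno
  have hstep : ∀ k : ℕ, l.part (i - k) 0 = n := by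
    intro k
    induction k with
    | zero => simpa using hi
    | succ k ih =>
      have hz : c (i - k) = 0 := by
        by_contra h
        exact hno _ h ih
      have h := l.cylindric (i - (k + 1 : ℕ)) 0
      have he : i - ((k + 1 : ℕ) : ZMod r) + 1 = i - k := by push_cast; ring
      rw [he, hz, ih] at h
      exact le_antisymm (hl _) h
  obtain ⟨j, hj⟩ := Function.ne_iff.mp hc
  refine hno j hj ?_
  have := hstep (i - j).val
  rwa [ZMod.natCast_zmod_val, sub_sub_cancel] at this

/-! ### Inclusion–exclusion over the largest parts -/

/-- The generating function in `q` of the cylindric partitions of profile `c` with all parts at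
most `n`. -/
noncomputable def boundedGF (c : ZMod r → ℕ) (n : ℕ) : QSeries :=
  ∑' l : CylindricPartition c, qVar ^ l.size * (if ∀ i, l.part i 0 ≤ n then 1 else 0)

theorem tsum_largest_eq (n : ℕ) {J : Finset (ZMod r)} (hJ : ∀ i ∈ J, c i ≠ 0) :
    ∑' l : CylindricPartition c, qVar ^ l.size *
        (if (∀ i, l.part i 0 ≤ n) ∧ ∀ i ∈ J, l.part i 0 = n then 1 else 0) =
      qVar ^ (n * J.card) * boundedGF (removalProfile c J) n := by
  have hconv : ∀ {d : ZMod r → ℕ} (p : CylindricPartition d → Prop) [DecidablePred p],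
      ∑' l : CylindricPartition d, qVar ^ l.size * (if p l then 1 else 0) =
        ∑' l : {l | p l}, qVar ^ l.1.size := by
    intro d p _
    rw [tsum_subtype {l | p l} fun l : CylindricPartition d => qVar ^ l.size]
    refine tsum_congr fun l => ?_
    rw [Set.indicator_apply, mul_ite, mul_one, mul_zero]
    rfl
  rw [boundedGF, hconv, hconv, ← (removeEquiv n hJ).symm.tsum_eq, ← Summable.tsum_mul_left]
  · refine tsum_congr fun l => ?_
    rw [size_removeEquiv_symm, pow_add]
  · have h := (summable_qVar_pow_size_mul (c := removalProfile c J) fun _ => 1).comp_injective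
      (Subtype.val_injective (p := fun l => ∀ i, l.part i 0 ≤ n))
    simp only [Function.comp_def, mul_one] at h
    exact h

theorem sum_powerset_indicator {ι : Type*} (s : Finset ι) (p : ι → Prop) [DecidablePred p] :
    ∑ J ∈ s.powerset, (-1 : QSeries) ^ J.card * (if ∀ i ∈ J, p i then 1 else 0) =
      if ∀ i ∈ s, ¬ p i then 1 else 0 := by
  have h : ∏ i ∈ s, (1 + -(if p i then (1 : QSeries) else 0)) =
      if ∀ i ∈ s, ¬ p i then 1 else 0 := by
    rw [← Finset.prod_const_one (s := s), ← Finset.prod_ite_zero]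
    refine Finset.prod_congr rfl fun i _ => ?_
    split_ifs <;> simp_all
  rw [← h, Finset.prod_one_add]
  refine Finset.sum_congr rfl fun J _ => ?_
  rw [Finset.prod_neg, Finset.prod_ite_zero, Finset.prod_const_one]

theorem sum_powerset_boundedGF (hc : c ≠ 0) (n : ℕ) :
    ∑ J ∈ (Finset.univ.filter fun i => c i ≠ 0).powerset,
        (-1) ^ J.card * (qVar ^ (n * J.card) * boundedGF (removalProfile c J) n) =
      ∑' l : CylindricPartition c, qVar ^ l.size * (if ∀ i, l.part i 0 < n then 1 else 0) := by
  have hmem : ∀ J ∈ (Finset.univ.filter fun i => c i ≠ 0).powerset, ∀ i ∈ J, c i ≠ 0 := by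
    intro J hJ i hi
    exact (Finset.mem_filter.mp (Finset.mem_powerset.mp hJ hi)).2
  rw [Finset.sum_congr rfl fun J hJ => by rw [← tsum_largest_eq n (hmem J hJ),
    ← (summable_qVar_pow_size_mul _).tsum_mul_left],
    ← Summable.tsum_finsetSum fun J _ => (summable_qVar_pow_size_mul _).mul_left _]
  refine tsum_congr fun l => ?_
  have h := sum_powerset_indicator (Finset.univ.filter fun i => c i ≠ 0) fun i => l.part i 0 = n
  by_cases hl : ∀ i, l.part i 0 ≤ n
  · have hiff : (∀ i ∈ Finset.univ.filter fun i => c i ≠ 0, ¬ l.part i 0 = n) ↔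
        ∀ i, l.part i 0 < n := by
      refine ⟨fun hne i => lt_of_le_of_ne (hl i) fun hi => ?_, fun hlt i _ => (hlt i).ne⟩
      obtain ⟨i', h1, h2⟩ := exists_ne_zero_of_part_zero_eq hc l hl hi
      exact hne i' (Finset.mem_filter.mpr ⟨Finset.mem_univ _, h1⟩) h2
    simp only [hiff] at h
    simp only [hl, implies_true, true_and]
    rw [← h, Finset.mul_sum]
    exact Finset.sum_congr rfl fun J _ => by rw [mul_left_comm]; congr
  · rw [if_neg fun hlt => hl fun i => (hlt i).le]
    simp [hl]

/-- The generating function of pairs of a bound `n`, marked by `x`, and a cylindric partition with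
all parts at most `n`; equivalently `F_c(x, q) / (1 - x)`. -/
noncomputable def boundedSeries (c : ZMod r → ℕ) : XQSeries :=
  PowerSeries.mk (boundedGF c)

/-- The factor `x` on the right accounts for lowering the bound on the parts from `n` to `n - 1`;
for `n = 0` no part is smaller than the bound, and both sides have vanishing coefficient. -/
theorem sum_powerset_boundedSeries (hc : c ≠ 0) :
    ∑ J ∈ (Finset.univ.filter fun i => c i ≠ 0).powerset,
        (-1) ^ J.card * qShift J.card (boundedSeries (removalProfile c J)) =
      xVar * boundedSeries c := by
  ext1 n
  have h := sum_powerset_boundedGF hc n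
  have hs : ∀ k : ℕ, ((-1) ^ k : XQSeries) = C ((-1) ^ k) := by simp
  rw [map_sum]
  simp only [hs, coeff_C_mul, coeff_qShift, boundedSeries, coeff_mk, mul_comm _ n]
  rw [h]
  rcases n with _ | n
  · simp [xVar]
  · rw [xVar, coeff_succ_X_mul, coeff_mk, boundedGF]
    simp only [Nat.lt_succ_iff]

theorem weight_eq (l : CylindricPartition c) : l.weight = xVar ^ l.max * C (qVar ^ l.size) := by
  rw [weight, qVar', map_pow]

theorem summable_weight (c : ZMod r → ℕ) :
    Summable fun l : CylindricPartition c => l.weight := by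
  refine XQSeries.summable_of_finite_coeff fun n m => (finite_size_le c m).subset fun l hl => ?_
  by_contra h
  apply hl
  rw [weight_eq, coeff_xVar_pow_mul_C]
  split_ifs
  · rw [qVar, coeff_X_pow, if_neg (by rw [Set.mem_ofPred_eq] at h; omega)]
  · rw [map_zero]

theorem cylF_eq (c : ZMod r → ℕ) : cylF c = (1 - xVar) * boundedSeries c := by
  ext1 n
  rw [cylF, XQSeries.coeff_tsum (summable_weight c), sub_mul, one_mul, map_sub, xVar]
  rcases n with _ | n
  · rw [coeff_zero_X_mul, sub_zero, boundedSeries, coeff_mk, boundedGF]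
    refine tsum_congr fun l => ?_
    rw [weight_eq, coeff_xVar_pow_mul_C, mul_ite, mul_one, mul_zero]
    refine if_congr ?_ rfl rfl
    rw [← max_le_iff_part_zero_le, Nat.le_zero, eq_comm]
  · rw [coeff_succ_X_mul, boundedSeries, coeff_mk, coeff_mk, boundedGF, boundedGF,
      ← (summable_qVar_pow_size_mul _).tsum_sub (summable_qVar_pow_size_mul _)]
    refine tsum_congr fun l => ?_
    rw [weight_eq, coeff_xVar_pow_mul_C]
    simp only [← max_le_iff_part_zero_le]
    split_ifs <;> first | omega | simp

end CylindricPartition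

/-! ### The functional equations of Corteel and Welsh -/

section FunctionalEquation

open CylindricPartition

variable {r : ℕ} [NeZero r] {c : ZMod r → ℕ}

theorem qPochInf_eq_qPoch_mul_qShift (k : ℕ) :
    qPochInf (xVar * qVar') qVar' =
      qPoch (xVar * qVar') qVar' k * qShift k (qPochInf (xVar * qVar') qVar') := by
  induction k with
  | zero => simp [qPoch, qShift_zero]
  | succ k ih =>
    have h := congrArg (qShift k) qPochInf_eq_mul_qShift
    simp only [map_mul, map_sub, map_one, qShift_xVar, qShift_qVar', qShift_qShift] at h
    rw [qPoch_succ]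
    linear_combination ih + qPoch (xVar * qVar') qVar' k * h

theorem qPochInf_mul_qShift_boundedSeries (c : ZMod r → ℕ) (k : ℕ) :
    qPochInf (xVar * qVar') qVar' * qShift (k + 1) (boundedSeries c) =
      qPoch (xVar * qVar') qVar' k * qShift (k + 1) (cylG c) := by
  have h := qPochInf_eq_qPoch_mul_qShift (k + 1)
  rw [qPoch_succ] at h
  rw [cylG, cylF_eq]
  simp only [map_mul, map_sub, map_one, qShift_xVar]
  linear_combination qShift (k + 1) (boundedSeries c) * h

/-- The Corteel–Welsh functional equation, obtained from inclusion–exclusion over the set `J` of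
indices of the first parts that are equal to the bound on the parts. -/
theorem cylG_eq_sum (hc : c ≠ 0) :
    cylG c = ∑ J ∈ (Finset.univ.filter fun i => c i ≠ 0).powerset.erase ∅,
      (-1) ^ (J.card - 1) * qPoch (xVar * qVar') qVar' (J.card - 1) *
        qShift J.card (cylG (removalProfile c J)) := by
  have h := sum_powerset_boundedSeries hc
  have he : removalProfile c ∅ = c := by
    funext i
    simp [removalProfile]
  rw [← Finset.add_sum_erase _ _ (Finset.empty_mem_powerset _), Finset.card_empty, he, pow_zero,
    one_mul, qShift_zero] at h
  have hsum : ∑ J ∈ (Finset.univ.filter fun i => c i ≠ 0).powerset.erase ∅,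
      (-1) ^ (J.card - 1) * qPoch (xVar * qVar') qVar' (J.card - 1) *
        qShift J.card (cylG (removalProfile c J)) =
      -qPochInf (xVar * qVar') qVar' *
        ∑ J ∈ (Finset.univ.filter fun i => c i ≠ 0).powerset.erase ∅,
          (-1) ^ J.card * qShift J.card (boundedSeries (removalProfile c J)) := by
    rw [Finset.mul_sum]
    refine Finset.sum_congr rfl fun J hJ => ?_
    obtain ⟨k, hk⟩ := Nat.exists_eq_succ_of_ne_zero
      (Finset.card_ne_zero.mpr (Finset.nonempty_iff_ne_empty.mpr (Finset.ne_of_mem_erase hJ)))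
    have := qPochInf_mul_qShift_boundedSeries (removalProfile c J) k
    simp only [hk, Nat.succ_eq_add_one, Nat.add_sub_cancel]
    linear_combination -(-1) ^ k * this
  rw [hsum, cylG, cylF_eq]
  linear_combination qPochInf (xVar * qVar') qVar' * h

theorem coeff_zero_cylG (c : ZMod r → ℕ) : coeff 0 (cylG c) = 1 := by
  -- Only the empty cylindric partition has no positive part.
  let e : CylindricPartition c :=
    { part := fun _ => 0
      antitone_part := fun _ _ _ _ => le_rfl
      cylindric := fun _ _ => le_rfl }
  have h : boundedGF c 0 = 1 := by
    rw [boundedGF, tsum_eq_single e]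
    · simp [e, size]
    · intro l hl
      rw [if_neg, mul_zero]
      intro h0
      apply hl
      ext i j
      exact Nat.le_zero.mp ((l.antitone_part i (Nat.zero_le j)).trans (h0 i))
  have hP := coeff_zero_qPochInf
  rw [coeff_zero_eq_constantCoeff_apply] at hP ⊢
  rw [cylG, cylF_eq, map_mul, map_mul, hP, ← coeff_zero_eq_constantCoeff_apply (boundedSeries c),
    boundedSeries, coeff_mk, h]
  simp [xVar]

/-- Relabelling the components of a cylindric partition cyclically. -/
def CylindricPartition.rotate (c : ZMod r → ℕ) (k : ZMod r) :
    CylindricPartition c ≃ CylindricPartition fun i => c (i + k) where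
  toFun l :=
    { part := fun i => l.part (i + k)
      antitone_part := fun i => l.antitone_part (i + k)
      cylindric := fun i j => by
        have := l.cylindric (i + k) j
        rwa [add_right_comm] at this }
  invFun l :=
    { part := fun i => l.part (i - k)
      antitone_part := fun i => l.antitone_part (i - k)
      cylindric := fun i j => by
        have := l.cylindric (i - k) j
        rwa [sub_add_eq_add_sub, sub_add_cancel] at this }
  left_inv l := by ext; simp
  right_inv l := by ext; simp

theorem cylG_rotate (c : ZMod r → ℕ) (k : ZMod r) : cylG (fun i => c (i + k)) = cylG c := by
  rw [cylG, cylG, cylF, cylF, ← (rotate c k).tsum_eq]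
  congr 1
  refine tsum_congr fun l => ?_
  have h1 : (rotate c k l).size = l.size :=
    Equiv.sum_comp (Equiv.addRight k) fun i => (l.part i).sum fun _ m => m
  have h2 : (rotate c k l).max = l.max := by
    refine eq_of_forall_ge_iff fun n => ?_
    rw [max_le_iff_part_zero_le, max_le_iff_part_zero_le]
    exact (Equiv.addRight k).forall_congr_right (q := fun i => l.part i 0 ≤ n)
  rw [weight, weight, h1, h2]

end FunctionalEquation

/-! ### The profiles of level three -/

/-- The profile `(a, b, c)`, indexed by `ℤ/3ℤ`. -/
def profile (a b c : ℕ) : ZMod 3 → ℕ :=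
  ![a, b, c]

theorem cylG_profile_rotate (a b c : ℕ) : cylG (profile b c a) = cylG (profile a b c) := by
  rw [← cylG_rotate (profile a b c) 1]
  congr 1
  funext i
  fin_cases i <;> rfl

theorem cylG_300 : cylG (profile 3 0 0) = qShift 1 (cylG (profile 2 1 0)) := by
  have hs : (Finset.univ.filter fun i => profile 3 0 0 i ≠ 0).powerset.erase ∅ = {{0}} := by
    decide
  have h0 : removalProfile (profile 3 0 0) {0} = profile 2 1 0 := by decide
  rw [cylG_eq_sum (by decide), hs, Finset.sum_singleton, h0]
  simp [qPoch]

theorem cylG_210 : cylG (profile 2 1 0) = 2 * qShift 1 (cylG (profile 2 0 1)) -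
    (1 - xVar * qVar') * qShift 2 (cylG (profile 1 1 1)) := by
  have hs : (Finset.univ.filter fun i => profile 2 1 0 i ≠ 0).powerset.erase ∅ =
      {{0}, {1}, {0, 1}} := by
    decide
  have h0 : removalProfile (profile 2 1 0) {0} = profile 1 2 0 := by decide
  have h1 : removalProfile (profile 2 1 0) {1} = profile 2 0 1 := by decide
  have h01 : removalProfile (profile 2 1 0) {0, 1} = profile 1 1 1 := by decide
  have hc : ({0, 1} : Finset (ZMod 3)).card = 2 := by decide
  rw [cylG_eq_sum (by decide), hs, Finset.sum_insert (by decide), Finset.sum_insert (by decide),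
    Finset.sum_singleton, h0, h1, h01, hc, ← cylG_profile_rotate 1 2 0]
  simp [qPoch]
  ring

theorem cylG_201 : cylG (profile 2 0 1) = qShift 1 (cylG (profile 1 1 1)) +
    qShift 1 (cylG (profile 3 0 0)) - (1 - xVar * qVar') * qShift 2 (cylG (profile 2 1 0)) := by
  have hs : (Finset.univ.filter fun i => profile 2 0 1 i ≠ 0).powerset.erase ∅ =
      {{0}, {2}, {0, 2}} := by
    decide
  have h0 : removalProfile (profile 2 0 1) {0} = profile 1 1 1 := by decide
  have h2 : removalProfile (profile 2 0 1) {2} = profile 3 0 0 := by decide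
  have h02 : removalProfile (profile 2 0 1) {0, 2} = profile 2 1 0 := by decide
  have hc : ({0, 2} : Finset (ZMod 3)).card = 2 := by decide
  rw [cylG_eq_sum (by decide), hs, Finset.sum_insert (by decide), Finset.sum_insert (by decide),
    Finset.sum_singleton, h0, h2, h02, hc]
  simp [qPoch]
  ring

theorem cylG_111 : cylG (profile 1 1 1) = 3 * qShift 1 (cylG (profile 2 1 0)) -
    3 * (1 - xVar * qVar') * qShift 2 (cylG (profile 2 0 1)) +
    (1 - xVar * qVar') * (1 - xVar * qVar' ^ 2) * qShift 3 (cylG (profile 1 1 1)) := by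
  have hs : (Finset.univ.filter fun i => profile 1 1 1 i ≠ 0).powerset.erase ∅ =
      {{0}, {1}, {2}, {0, 1}, {0, 2}, {1, 2}, {0, 1, 2}} := by
    decide
  have h0 : removalProfile (profile 1 1 1) {0} = profile 0 2 1 := by decide
  have h1 : removalProfile (profile 1 1 1) {1} = profile 1 0 2 := by decide
  have h2 : removalProfile (profile 1 1 1) {2} = profile 2 1 0 := by decide
  have h01 : removalProfile (profile 1 1 1) {0, 1} = profile 0 1 2 := by decide
  have h02 : removalProfile (profile 1 1 1) {0, 2} = profile 1 2 0 := by decide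
  have h12 : removalProfile (profile 1 1 1) {1, 2} = profile 2 0 1 := by decide
  have h012 : removalProfile (profile 1 1 1) {0, 1, 2} = profile 1 1 1 := by decide
  have hc01 : ({0, 1} : Finset (ZMod 3)).card = 2 := by decide
  have hc02 : ({0, 2} : Finset (ZMod 3)).card = 2 := by decide
  have hc12 : ({1, 2} : Finset (ZMod 3)).card = 2 := by decide
  have hc012 : ({0, 1, 2} : Finset (ZMod 3)).card = 3 := by decide
  have r102 : cylG (profile 1 0 2) = cylG (profile 2 1 0) := cylG_profile_rotate 2 1 0
  have r021 : cylG (profile 0 2 1) = cylG (profile 2 1 0) :=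
    (cylG_profile_rotate 1 0 2).trans r102
  have r012 : cylG (profile 0 1 2) = cylG (profile 2 0 1) := cylG_profile_rotate 2 0 1
  have r120 : cylG (profile 1 2 0) = cylG (profile 2 0 1) :=
    (cylG_profile_rotate 0 1 2).trans r012
  refine (cylG_eq_sum (c := profile 1 1 1) (by decide)).trans ?_
  rw [hs, Finset.sum_insert (by decide), Finset.sum_insert (by decide),
    Finset.sum_insert (by decide), Finset.sum_insert (by decide), Finset.sum_insert (by decide),
    Finset.sum_insert (by decide), Finset.sum_singleton, h0, h1, h2, h01, h02, h12, h012, hc01,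
    hc02, hc12, hc012, r102, r021, r012, r120]
  simp [qPoch, Finset.prod_range_succ]
  ring

theorem cylG_300_eq :
    cylG (profile 3 0 0) = (1 + xVar * qVar' ^ 2) * qShift 3 (cylG (profile 1 1 1)) +
      2 * (xVar * qVar' ^ 3) * qShift 3 (cylG (profile 3 0 0)) := by
  have hB := congrArg (qShift 1) cylG_210
  have hC := congrArg (qShift 2) cylG_201
  have hD := congrArg (qShift 3) cylG_300
  simp only [map_add, map_sub, map_mul, map_one, map_ofNat, qShift_qShift, qShift_xVar,
    qShift_qVar', Nat.reduceAdd] at hB hC hD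
  linear_combination cylG_300 + hB + 2 * hC + 2 * (1 - xVar * qVar' ^ 3) * hD

theorem cylG_111_eq :
    cylG (profile 1 1 1) =
      (1 + 2 * (xVar * qVar') + 2 * (xVar * qVar' ^ 2) + xVar ^ 2 * qVar' ^ 3) *
          qShift 3 (cylG (profile 1 1 1)) +
        3 * (xVar * qVar' ^ 3) * (1 + xVar * qVar') * qShift 3 (cylG (profile 3 0 0)) := by
  have hB := congrArg (qShift 1) cylG_210
  have hC := congrArg (qShift 2) cylG_201
  have hD := congrArg (qShift 3) cylG_300
  simp only [map_add, map_sub, map_mul, map_one, map_ofNat, qShift_qShift, qShift_xVar,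
    qShift_qVar', Nat.reduceAdd] at hB hC hD
  linear_combination cylG_111 + 3 * hB + 3 * (1 + xVar * qVar') * hC +
    3 * (1 + xVar * qVar') * (1 - xVar * qVar' ^ 3) * hD

/-! ### Uniqueness of the solution -/

theorem xVar_pow_dvd_qShift {n : ℕ} {f : XQSeries} (k : ℕ) (h : xVar ^ n ∣ f) :
    xVar ^ n ∣ qShift k f := by
  rw [xVar, X_pow_dvd_iff] at h ⊢
  intro m hm
  rw [coeff_qShift, h m hm, mul_zero]

theorem xVar_pow_succ_dvd_of_dvd_sub_qShift {n k : ℕ} {f : XQSeries} (hk : k ≠ 0)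
    (h0 : coeff 0 f = 0) (h : xVar ^ n ∣ f - qShift k f) : xVar ^ n ∣ f := by
  rw [xVar, X_pow_dvd_iff] at h ⊢
  intro m hm
  rcases eq_or_ne m 0 with rfl | hm0
  · exact h0
  have h1 := h m hm
  rw [map_sub, coeff_qShift, ← one_sub_mul] at h1
  refine (mul_eq_zero.mp h1).resolve_left fun h2 => ?_
  have h3 := congrArg (constantCoeff (R := ℤ)) h2
  simp [qVar, hk, hm0] at h3

/-- Comparing coefficients of `x ^ n` for `n ≥ 1`, the first equation determines
`(1 - q ^ (3 n)) A_n` from the earlier coefficients of `A` and `D`, and then the second one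
determines `D_n`. The induction phrases this as divisibility of `A` and `D` by `x ^ n`. -/
theorem qShift_system_unique {A D : XQSeries} (hA : coeff 0 A = 0)
    (h1 : A = (1 + 2 * (xVar * qVar') + 2 * (xVar * qVar' ^ 2) + xVar ^ 2 * qVar' ^ 3) *
      qShift 3 A + 3 * (xVar * qVar' ^ 3) * (1 + xVar * qVar') * qShift 3 D)
    (h2 : D = (1 + xVar * qVar' ^ 2) * qShift 3 A + 2 * (xVar * qVar' ^ 3) * qShift 3 D) :
    A = 0 := by
  have key : ∀ n : ℕ, xVar ^ n ∣ A ∧ xVar ^ n ∣ D := by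
    intro n
    induction n with
    | zero => simp
    | succ n ih =>
      obtain ⟨u, hu⟩ := xVar_pow_dvd_qShift 3 ih.1
      obtain ⟨v, hv⟩ := xVar_pow_dvd_qShift 3 ih.2
      have hdA : xVar ^ (n + 1) ∣ A := by
        refine xVar_pow_succ_dvd_of_dvd_sub_qShift three_ne_zero hA
          ⟨(2 * qVar' + 2 * qVar' ^ 2 + xVar * qVar' ^ 3) * u +
            3 * qVar' ^ 3 * (1 + xVar * qVar') * v, ?_⟩
        rw [hu, hv] at h1
        rw [hu]
        linear_combination h1
      obtain ⟨w, hw⟩ := xVar_pow_dvd_qShift 3 hdA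
      refine ⟨hdA, ⟨(1 + xVar * qVar' ^ 2) * w + 2 * qVar' ^ 3 * v, ?_⟩⟩
      rw [hw, hv] at h2
      linear_combination h2
  ext1 n
  exact (X_pow_dvd_iff.mp (key (n + 1)).1) n n.lt_succ_self

theorem proposition7p2 :
    Summable (fun l : CylindricPartition profile111 => l.weight) ∧
    Multipliable (fun j : ℕ => (1 - xVar * qVar' * qVar' ^ j : XQSeries)) ∧
    HasSum
      (fun p : ℕ × ℕ × ℕ × ℕ =>
        match p with
        | (a, b, c, d) =>
          (PowerSeries.C (agCoeff a b c d) * xVar ^ (a + b + c + 2 * d) : XQSeries))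
      (cylG profile111) := by
  refine ⟨CylindricPartition.summable_weight _, multipliable_one_sub_x_mul_q_pow, ?_⟩
  have hp : profile111 = profile 1 1 1 := by decide
  have hsum : cylG profile111 = agSum 0 0 0 0 := by
    have hA := cylG_111_eq
    have hD := cylG_300_eq
    have hS := agSum_0000_eq
    have hT := agSum_1233_eq
    rw [hp, ← sub_eq_zero]
    refine qShift_system_unique (D := cylG (profile 3 0 0) - agSum 1 2 3 3) ?_ ?_ ?_
    · rw [map_sub, coeff_zero_cylG, coeff_zero_agSum, sub_self]
    · rw [map_sub, map_sub]
      linear_combination hA - hS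
    · rw [map_sub, map_sub]
      linear_combination hD - hT
  rw [hsum]
  have hterm : ∀ p : ℕ × ℕ × ℕ × ℕ, agTerm 0 0 0 0 p =
      C (agCoeff p.1 p.2.1 p.2.2.1 p.2.2.2) * xVar ^ (p.1 + p.2.1 + p.2.2.1 + 2 * p.2.2.2) := by
    intro p
    simp [agTerm, mul_comm]
  exact (summable_agTerm 0 0 0 0).hasSum.congr_fun fun p => (hterm p).symm
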